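/- For a finite positive Borel measure $\eta$ on $[0,1)$ let $$\kappa_\eta(r)=\frac{2\,\eta([r,1))}{1-r^2}\qquad(0\le r<1).$$ Let $\mathfrak{M}_{\mathbb C}$ be the set of all finite complex Borel measures on $[0,1)$ of the form $\eta=\eta_1-\eta_2+i(\eta_3-\eta_4)$, where $\eta_1,\eta_2,\eta_3,\eta_4$ are finite positive Borel measures on $[0,1)$ such that each function $\kappa_{\eta_j}$ is bounded. For $\eta\in\mathfrak{M}_{\mathbb C}$ define the sequence $$\gamma_\eta(k)=2(k+1)\int_{[0,1)} r^{2k}\,d\eta(r)\qquad(k\in\mathbb{N}_0=\{0,1,2,\dots\}).$$ Let $d_{\log}(m,n)=|\log(m+1)-\log(n+1)|$ for $m,n\in\mathbb{N}_0$, and let $\operatorname{BUC}(\mathbb{N}_0,d_{\log})$ be the set of all bounded complex sequences on $\mathbb{N}_0$ that are uniformly continuous with respect to $d_{\log}$, regarded as a subset of $\ell^\infty(\mathbb{N}_0)$ with the supremum norm. Then every $\gamma_\eta$ with $\eta\in\mathfrak{M}_{\mathbb C}$ is a bounded sequence, and $\{\gamma_\eta:\eta\in\mathfrak{M}_{\mathbb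 C}\}$ is a dense subset of $\operatorname{BUC}(\mathbb{N}_0,d_{\log})$. Moreover, the C*-subalgebra of $\ell^\infty(\mathbb{N}_0)$ generated by $\{\gamma_\eta:\eta\in\mathfrak{M}_{\mathbb C}\}$ (the smallest norm-closed, not necessarily unital, *-subalgebra containing this set) coincides with $\operatorname{BUC}(\mathbb{N}_0,d_{\log})$. -/

import Mathlib

open MeasureTheory Set
open scoped ENNReal

noncomputable section

namespace RadialToeplitz

/-- The half-open interval `[0,1)` as a measurable space (with its Borel sigma-algebra). -/
abbrev UnitIco : Type := Set.Ico (0 : ℝ) 1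

/-- The average function of a measure on `[0,1)`:
`κ_η(r) = η([r,1)) / ((1 - r²) / 2) = 2 η([r,1)) / (1 - r²)`.
In the subtype `[0,1)`, the interval `[r,1)` is `Set.Ici r`. -/
def kappa (η : Measure UnitIco) (r : UnitIco) : ℝ :=
  2 * η.real (Set.Ici r) / (1 - (r : ℝ) ^ 2)

/-- `κ_η` is a bounded function on `[0,1)` (it is nonnegative, so only the upper bound matters). -/
def HasBoundedKappa (η : Measure UnitIco) : Prop :=
  BddAbove (Set.range (kappa η))

/-- The class of complex Borel measures on `[0,1)` of the form `η₁ - η₂ + i (η₃ - η₄)`, where the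
`ηⱼ` are finite positive Borel measures with bounded `κ`. -/
def complexMeasureClass : Set (ComplexMeasure UnitIco) :=
  {η | ∃ (η₁ η₂ η₃ η₄ : Measure UnitIco)
      (_ : IsFiniteMeasure η₁) (_ : IsFiniteMeasure η₂)
      (_ : IsFiniteMeasure η₃) (_ : IsFiniteMeasure η₄),
      HasBoundedKappa η₁ ∧ HasBoundedKappa η₂ ∧ HasBoundedKappa η₃ ∧ HasBoundedKappa η₄ ∧
      η = SignedMeasure.toComplexMeasure
        (η₁.toSignedMeasure - η₂.toSignedMeasure) (η₃.toSignedMeasure - η₄.toSignedMeasure)}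

/-- The eigenvalue sequence `γ_η(k) = 2 (k+1) ∫_{[0,1)} r^{2k} dη(r)` of a complex measure `η`
(Mathlib's integral of a real function with respect to a vector measure). -/
def gammaSeq (η : ComplexMeasure UnitIco) (k : ℕ) : ℂ :=
  2 * ((k : ℂ) + 1) *
    VectorMeasure.integral η (fun r : UnitIco => (r : ℝ) ^ (2 * k))
      (ContinuousLinearMap.lsmul ℝ ℝ)

/-- The logarithmic distance on `ℕ = {0,1,2,…}`. -/
def dLog (m n : ℕ) : ℝ := |Real.log ((m : ℝ) + 1) - Real.log ((n : ℝ) + 1)|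

/-- The C*-algebra `ℓ^∞(ℕ)` of bounded complex sequences with the supremum norm. -/
abbrev LInf : Type := lp (fun _ : ℕ => ℂ) ∞

/-- The bounded complex sequences that are uniformly continuous with respect to `dLog`. -/
def BUC : Set LInf :=
  {x | ∀ ε : ℝ, 0 < ε → ∃ δ : ℝ, 0 < δ ∧ ∀ m n : ℕ, dLog m n < δ → ‖x m - x n‖ < ε}

/-- The set `{γ_η : η ∈ complexMeasureClass}`, as a set of bounded sequences. -/
def gammaSet : Set LInf :=
  {x | ∃ η ∈ complexMeasureClass, ∀ k : ℕ, x k = gammaSeq η k}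

/-- The C*-subalgebra of `ℓ^∞(ℕ)` generated by a set: the closure of the (not necessarily unital)
star-subalgebra generated by the set. -/
def cstarGenerated (S : Set LInf) : NonUnitalStarSubalgebra ℂ LInf :=
  (NonUnitalStarAlgebra.adjoin ℂ S).topologicalClosure

end RadialToeplitz

end

/-! Membership in `BUC` comes from a Lipschitz bound with respect to `dLog`. If `kappa` is bounded,
the tails `η([r,1))` are at most `C (1 - r²)`, so the even moments `I_k = ∫ r^(2k) dη` are
`O(1/(k+1))` and their consecutive differences are `O(1/(k+1)²)` (`integral_pow_le`,
`integral_pow_sub_le`). The increments of `2(k+1) I_k` are then `O(1/(k+2))`, comparable to the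
logarithmic steps (`exists_momentSeq_bounds`).

For density, substitute `r = exp(-ct/2)`. Measures with density `b(t) exp(-ct)` yield the sequences
`x ∫ exp(-cxt) b(t) dt` with `x = k + 1`. Combining `c = 1, 2, ...` replaces the kernel by `E p(E)`,
with `E = exp(-xt)` and `p` any polynomial. By Weierstrass, `p` may approximate a bump `ψ` that
forces `xt` into a short window just below 1. With `b(t) = σ(⌊1/t⌋ - 1)` the integral then averages
`σ` over indices `dLog`-close to `k`, and the total weight does not depend on `k` by scaling
(`exists_mem_momentSubmodule_near_of_nonneg`).

Finally, `BUC` is itself a closed star-subalgebra, so it is the generated C*-algebra. -/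

noncomputable section

namespace RadialToeplitz

/-! ### Integration against complex measures, reduced to positive measures. -/

section ComplexMeasureIntegral

variable {X : Type*} [MeasurableSpace X]

/-- Each real integral is pushed into `ℂ` by `a ↦ a` or `a ↦ I * a`; the integral is then additive
in the set function being integrated against, provided the variation of `s + I t` is at most the sum
of the two variations, which is checked set by set. -/
theorem integral_toComplexMeasure {s t : SignedMeasure X} {f : X → ℝ}
    (hs : VectorMeasure.Integrable s f) (ht : VectorMeasure.Integrable t f) :
    VectorMeasure.integral (s.toComplexMeasure t) f (ContinuousLinearMap.lsmul ℝ ℝ) =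
      ((VectorMeasure.integral s f (ContinuousLinearMap.lsmul ℝ ℝ) : ℝ) : ℂ) +
        Complex.I * ((VectorMeasure.integral t f (ContinuousLinearMap.lsmul ℝ ℝ) : ℝ) : ℂ) := by
  have h1 := VectorMeasure.continuousLinearMap_apply_integral
    (B := ContinuousLinearMap.lsmul ℝ ℝ) (C := Complex.ofRealCLM) hs
  have h2 := VectorMeasure.continuousLinearMap_apply_integral
    (B := ContinuousLinearMap.lsmul ℝ ℝ)
    (C := (ContinuousLinearMap.mul ℝ ℂ Complex.I).comp Complex.ofRealCLM) ht
  simp only [Complex.ofRealCLM_apply, ContinuousLinearMap.comp_apply,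
    ContinuousLinearMap.mul_apply'] at h1 h2
  have hval : ∀ u : Set X, s.toComplexMeasure t u = (s u : ℂ) + Complex.I * (t u : ℂ) := fun u => by
    rw [SignedMeasure.toComplexMeasure_apply]
    apply Complex.ext <;> simp
  rw [h1, h2]
  refine setToFun_add_left'' (fun u hu _ => ?_) hs ht ?_
    (ContinuousLinearMap.opNorm_nonneg _) (ContinuousLinearMap.opNorm_nonneg _)
    (ContinuousLinearMap.opNorm_nonneg _)
  · ext
    rw [_root_.add_apply]
    simp only [transpose_eq_cbmApplyMeasure, cbmApplyMeasure_apply, hval]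
    simp
  · refine VectorMeasure.variation_le_of_forall_enorm_le fun u hu => ?_
    rw [hval]
    refine (enorm_add_le _ _).trans ?_
    rw [Measure.add_apply]
    refine add_le_add ?_ ?_
    · refine le_trans (le_of_eq ?_) (VectorMeasure.enorm_measure_le_variation s u)
      simp [← ofReal_norm]
    · refine le_trans (le_of_eq ?_) (VectorMeasure.enorm_measure_le_variation t u)
      simp [← ofReal_norm]

theorem integral_lsmul_toSignedMeasure (μ : Measure X) [IsFiniteMeasure μ] (f : X → ℝ) :
    VectorMeasure.integral μ.toSignedMeasure f (ContinuousLinearMap.lsmul ℝ ℝ) = ∫ x, f x ∂μ := by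
  have h : (ContinuousLinearMap.lsmul ℝ ℝ : ℝ →L[ℝ] ℝ →L[ℝ] ℝ) =
      (ContinuousLinearMap.lsmul ℝ ℝ).flip := by
    ext
    simp
  rw [h, VectorMeasure.integral_toSignedMeasure]

theorem integral_toSignedMeasure_sub {μ ν : Measure X} [IsFiniteMeasure μ] [IsFiniteMeasure ν]
    {f : X → ℝ} (hμ : Integrable f μ) (hν : Integrable f ν) :
    VectorMeasure.integral (μ.toSignedMeasure - ν.toSignedMeasure) f
      (ContinuousLinearMap.lsmul ℝ ℝ) = ∫ x, f x ∂μ - ∫ x, f x ∂ν := by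
  rw [VectorMeasure.integral_sub_vectorMeasure (by simpa [VectorMeasure.Integrable] using hμ)
    (by simpa [VectorMeasure.Integrable] using hν), integral_lsmul_toSignedMeasure,
    integral_lsmul_toSignedMeasure]

end ComplexMeasureIntegral

/-! ### Moments under bounded `kappa`: decay and logarithmic Lipschitz bounds. -/

theorem integrable_pow_coe (η : Measure UnitIco) [IsFiniteMeasure η] (n : ℕ) :
    Integrable (fun r : UnitIco => (r : ℝ) ^ n) η := by
  refine Integrable.of_bound (C := 1) (by fun_prop) (Filter.Eventually.of_forall fun r => ?_)
  rw [Real.norm_eq_abs, abs_of_nonneg (pow_nonneg r.2.1 n)]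
  exact pow_le_one₀ r.2.1 r.2.2.le

/-- The eigenvalue sequence of a positive measure. -/
def momentSeq (η : Measure UnitIco) (k : ℕ) : ℝ :=
  2 * ((k : ℝ) + 1) * ∫ r : UnitIco, (r : ℝ) ^ (2 * k) ∂η

theorem gammaSeq_toComplexMeasure (η₁ η₂ η₃ η₄ : Measure UnitIco)
    [IsFiniteMeasure η₁] [IsFiniteMeasure η₂] [IsFiniteMeasure η₃] [IsFiniteMeasure η₄] (k : ℕ) :
    gammaSeq (SignedMeasure.toComplexMeasure
        (η₁.toSignedMeasure - η₂.toSignedMeasure) (η₃.toSignedMeasure - η₄.toSignedMeasure)) k =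
      ((momentSeq η₁ k - momentSeq η₂ k : ℝ) : ℂ) +
        Complex.I * ((momentSeq η₃ k - momentSeq η₄ k : ℝ) : ℂ) := by
  have hi : ∀ (μ ν : Measure UnitIco) [IsFiniteMeasure μ] [IsFiniteMeasure ν],
      VectorMeasure.Integrable (μ.toSignedMeasure - ν.toSignedMeasure)
        (fun r : UnitIco => (r : ℝ) ^ (2 * k)) := fun μ ν _ _ =>
    VectorMeasure.Integrable.sub_vectorMeasure
      (by simpa [VectorMeasure.Integrable] using integrable_pow_coe μ (2 * k))
      (by simpa [VectorMeasure.Integrable] using integrable_pow_coe ν (2 * k))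
  rw [gammaSeq, integral_toComplexMeasure (hi _ _) (hi _ _),
    integral_toSignedMeasure_sub (integrable_pow_coe _ _) (integrable_pow_coe _ _),
    integral_toSignedMeasure_sub (integrable_pow_coe _ _) (integrable_pow_coe _ _)]
  simp only [momentSeq]
  push_cast
  ring

theorem HasBoundedKappa.exists_bound {η : Measure UnitIco} (h : HasBoundedKappa η) :
    ∃ C : ℝ, 0 ≤ C ∧ ∀ r : UnitIco, η.real (Set.Ici r) ≤ C * (1 - (r : ℝ) ^ 2) := by
  obtain ⟨M, hM⟩ := h
  have hpos : ∀ r : UnitIco, 0 < 1 - (r : ℝ) ^ 2 := fun r => by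
    have := r.2.1; have := r.2.2; nlinarith
  have hk : ∀ r : UnitIco, 2 * η.real (Set.Ici r) / (1 - (r : ℝ) ^ 2) ≤ M :=
    fun r => hM ⟨r, rfl⟩
  refine ⟨M / 2, ?_, fun r => ?_⟩
  · have h0 : (0 : ℝ) ≤ M := le_trans (by
      have := hpos ⟨0, by simp⟩
      positivity) (hk ⟨0, by simp⟩)
    linarith
  · have := (div_le_iff₀ (hpos r)).1 (hk r)
    linarith

theorem integral_one_sub_rpow_inv (k : ℕ) (hk : k ≠ 0) :
    ∫ t in Ioc (0 : ℝ) 1, (1 - t ^ ((k : ℝ)⁻¹)) = 1 / ((k : ℝ) + 1) := by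
  have hk' : (0 : ℝ) < k := by positivity
  have hi : (0 : ℝ) < (k : ℝ)⁻¹ := by positivity
  rw [← intervalIntegral.integral_of_le zero_le_one, intervalIntegral.integral_sub (by simp)
    (intervalIntegral.intervalIntegrable_rpow' (by linarith)),
    integral_rpow (Or.inl (by linarith))]
  simp only [intervalIntegral.integral_const, smul_eq_mul, Real.one_rpow]
  rw [Real.zero_rpow (by linarith)]
  field_simp
  ring

/-- Layer cake: `{r^(2k) ≥ t}` is `[t^(1/(2k)), 1)`, of mass at most `C (1 - t^(1/k))`, and this is
integrated over `t ∈ (0,1]`. The case `k = 0` is the tail bound at `r = 0`. -/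
theorem integral_pow_le {η : Measure UnitIco} [IsFiniteMeasure η] {C : ℝ}
    (h : ∀ r : UnitIco, η.real (Set.Ici r) ≤ C * (1 - (r : ℝ) ^ 2)) (k : ℕ) :
    ∫ r : UnitIco, (r : ℝ) ^ (2 * k) ∂η ≤ C / ((k : ℝ) + 1) := by
  rcases eq_or_ne k 0 with rfl | hk
  · have h0 := h ⟨0, by simp⟩
    have hu : Set.Ici (⟨0, by simp⟩ : UnitIco) = Set.univ :=
      Set.eq_univ_of_forall fun x => x.2.1
    rw [hu] at h0
    simpa using h0
  have hk' : (0 : ℝ) < k := by positivity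
  have hi : (0 : ℝ) < (k : ℝ)⁻¹ := by positivity
  rw [(integrable_pow_coe η (2 * k)).integral_eq_integral_Ioc_meas_le (M := 1)
    (Filter.Eventually.of_forall fun r => pow_nonneg r.2.1 _)
    (Filter.Eventually.of_forall fun r => pow_le_one₀ r.2.1 r.2.2.le)]
  calc ∫ t in Ioc (0 : ℝ) 1, η.real {a : UnitIco | t ≤ (a : ℝ) ^ (2 * k)}
      ≤ ∫ t in Ioc (0 : ℝ) 1, C * (1 - t ^ ((k : ℝ)⁻¹)) := by
        refine integral_mono_of_nonneg (Filter.Eventually.of_forall fun t => measureReal_nonneg) ?_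
          ?_
        · refine Integrable.const_mul (Integrable.sub (integrable_const _) ?_) _
          exact (intervalIntegral.intervalIntegrable_rpow' (by linarith)).1
        · refine (ae_restrict_iff' measurableSet_Ioc).2 (Filter.Eventually.of_forall fun t ht => ?_)
          -- At `t = 1` the endpoint `t^(1/(2k))` is not a point of `[0,1)`, but the superlevel set
          -- is empty.
          rcases ht.2.eq_or_lt with rfl | h1
          · have : {a : UnitIco | (1 : ℝ) ≤ (a : ℝ) ^ (2 * k)} = ∅ := by
              ext a
              simpa using pow_lt_one₀ a.2.1 a.2.2 (by omega)
            simp [this]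
          · have hs0 : 0 ≤ t ^ (((2 * k : ℕ) : ℝ)⁻¹) := Real.rpow_nonneg ht.1.le _
            have hs1 : t ^ (((2 * k : ℕ) : ℝ)⁻¹) < 1 :=
              Real.rpow_lt_one ht.1.le h1 (by positivity)
            have hsq : (t ^ (((2 * k : ℕ) : ℝ)⁻¹)) ^ 2 = t ^ ((k : ℝ)⁻¹) := by
              rw [← Real.rpow_natCast, ← Real.rpow_mul ht.1.le]
              congr 1
              push_cast
              field_simp
            have hr := h ⟨t ^ (((2 * k : ℕ) : ℝ)⁻¹), hs0, hs1⟩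
            rw [hsq] at hr
            refine le_trans (measureReal_mono ?_) hr
            intro a ha
            have := Real.rpow_le_rpow ht.1.le ha (z := ((2 * k : ℕ) : ℝ)⁻¹) (by positivity)
            rwa [Real.pow_rpow_inv_natCast a.2.1 (by omega)] at this
    _ = C / ((k : ℝ) + 1) := by
        rw [integral_const_mul, integral_one_sub_rpow_inv k hk]
        ring

/-- The differences `I_j - I_(j+1) = ∫ r^(2j) (1 - r²) dη` decrease in `j`, so the last one is at
most the average over `N/2 ≤ j ≤ N`, a telescoping sum bounded by `I_(N/2)`. -/
theorem integral_pow_sub_le {η : Measure UnitIco} [IsFiniteMeasure η] {C : ℝ}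
    (h : ∀ r : UnitIco, η.real (Set.Ici r) ≤ C * (1 - (r : ℝ) ^ 2)) (hC : 0 ≤ C) (N : ℕ) :
    ∫ r : UnitIco, (r : ℝ) ^ (2 * N) ∂η - ∫ r : UnitIco, (r : ℝ) ^ (2 * (N + 1)) ∂η ≤
      4 * C / ((N : ℝ) + 1) ^ 2 := by
  set I : ℕ → ℝ := fun j => ∫ r : UnitIco, (r : ℝ) ^ (2 * j) ∂η with hI
  change I N - I (N + 1) ≤ _
  have hanti : ∀ j ≤ N, I N - I (N + 1) ≤ I j - I (j + 1) := by
    intro j hj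
    simp only [hI]
    rw [← integral_sub (integrable_pow_coe _ _) (integrable_pow_coe _ _),
      ← integral_sub (integrable_pow_coe _ _) (integrable_pow_coe _ _)]
    refine integral_mono ((integrable_pow_coe _ _).sub (integrable_pow_coe _ _))
      ((integrable_pow_coe _ _).sub (integrable_pow_coe _ _)) fun r => ?_
    have h0 := r.2.1
    have h1 := r.2.2
    have hp : (r : ℝ) ^ (2 * N) ≤ (r : ℝ) ^ (2 * j) :=
      pow_le_pow_of_le_one h0 h1.le (by omega)
    have hq : 0 ≤ 1 - (r : ℝ) ^ 2 := by nlinarith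
    calc (r : ℝ) ^ (2 * N) - (r : ℝ) ^ (2 * (N + 1)) = (r : ℝ) ^ (2 * N) * (1 - (r : ℝ) ^ 2) := by
          ring
      _ ≤ (r : ℝ) ^ (2 * j) * (1 - (r : ℝ) ^ 2) := mul_le_mul_of_nonneg_right hp hq
      _ = _ := by ring
  have hnonneg : 0 ≤ I (N + 1) := integral_nonneg fun r => pow_nonneg r.2.1 _
  have hsum : ∀ n m : ℕ, m + n ≤ N + 1 → (n : ℝ) * (I N - I (N + 1)) ≤ I m - I (m + n) := by
    intro n m hmn
    induction n with
    | zero => simp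
    | succ n ih =>
      have h1 := ih (by omega)
      have h2 := hanti (m + n) (by omega)
      push_cast
      rw [← add_assoc]
      linarith
  have hlast := hsum (N + 1 - N / 2) (N / 2) (by omega)
  rw [show N / 2 + (N + 1 - N / 2) = N + 1 by omega] at hlast
  have hm := integral_pow_le h (N / 2)
  -- Despite the floor in `N / 2`, both the number of terms and the denominator `N/2 + 1` are at
  -- least `(N+1)/2`; this gives the factor 4.
  have hcast : ((N : ℝ) + 1) / 2 ≤ ((N + 1 - N / 2 : ℕ) : ℝ) := by
    rw [div_le_iff₀ two_pos]
    norm_cast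
    omega
  have hcast' : ((N : ℝ) + 1) / 2 ≤ ((N / 2 : ℕ) : ℝ) + 1 := by
    rw [div_le_iff₀ two_pos]
    norm_cast
    omega
  have hD : 0 ≤ I N - I (N + 1) := by
    simp only [hI]
    rw [sub_nonneg]
    exact integral_mono (integrable_pow_coe _ _) (integrable_pow_coe _ _) fun r =>
      pow_le_pow_of_le_one r.2.1 r.2.2.le (by omega)
  have hN : (0 : ℝ) < (N : ℝ) + 1 := by positivity
  have hm' : I (N / 2) ≤ C / (((N : ℝ) + 1) / 2) :=
    hm.trans (div_le_div_of_nonneg_left hC (by positivity) hcast')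
  have hfin : ((N : ℝ) + 1) / 2 * (I N - I (N + 1)) ≤ C / (((N : ℝ) + 1) / 2) := by
    have := mul_le_mul_of_nonneg_right hcast hD
    linarith
  rw [le_div_iff₀ (by positivity)]
  rw [le_div_iff₀ (by positivity)] at hfin
  nlinarith

theorem momentSeq_nonneg (η : Measure UnitIco) (k : ℕ) : 0 ≤ momentSeq η k :=
  mul_nonneg (by positivity) (integral_nonneg fun r => pow_nonneg r.2.1 _)

theorem dLog_comm (m n : ℕ) : dLog m n = dLog n m := abs_sub_comm _ _

/-- Telescoping, since `log(m+2) - log(m+1) ≥ 1/(m+2)`. -/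
theorem abs_sub_le_mul_dLog {f : ℕ → ℝ} {K : ℝ}
    (h : ∀ k : ℕ, |f (k + 1) - f k| ≤ K / ((k : ℝ) + 2)) (m n : ℕ) :
    |f m - f n| ≤ K * dLog m n := by
  wlog hmn : n ≤ m generalizing m n
  · rw [abs_sub_comm, dLog_comm]
    exact this n m (le_of_not_ge hmn)
  have hK : 0 ≤ K := by
    have := (abs_nonneg _).trans (h 0)
    rwa [Nat.cast_zero, zero_add, le_div_iff₀ two_pos, zero_mul] at this
  have hle : ∀ n m : ℕ, n ≤ m → Real.log ((n : ℝ) + 1) ≤ Real.log ((m : ℝ) + 1) := by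
    intro n m hnm
    gcongr
  rw [dLog, abs_of_nonneg (sub_nonneg.2 (hle n m hmn))]
  induction m, hmn using Nat.le_induction with
  | base => simp
  | succ m hm ih =>
    have hstep : 1 / ((m : ℝ) + 2) ≤ Real.log (((m + 1 : ℕ) : ℝ) + 1) - Real.log ((m : ℝ) + 1) := by
      rw [← Real.log_div (by positivity) (by positivity)]
      refine le_trans (le_of_eq ?_) (Real.one_sub_inv_le_log_of_pos (by positivity))
      push_cast
      field_simp
      ring
    have hm1 := h m
    have := mul_le_mul_of_nonneg_left hstep hK
    rw [mul_one_div] at this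
    calc |f (m + 1) - f n| ≤ |f (m + 1) - f m| + |f m - f n| := abs_sub_le _ _ _
      _ ≤ _ := by linarith

/-- The increment equals `2 I_(k+1) - 2(k+1)(I_k - I_(k+1))`. The two nonnegative quantities
subtracted here are at most `2C/(k+2)` and `16C/(k+2)`, so the larger bound suffices. -/
theorem exists_momentSeq_bounds {η : Measure UnitIco} [IsFiniteMeasure η]
    (h : HasBoundedKappa η) :
    ∃ K : ℝ, 0 ≤ K ∧ (∀ k, |momentSeq η k| ≤ K) ∧
      ∀ m n, |momentSeq η m - momentSeq η n| ≤ K * dLog m n := by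
  obtain ⟨C, hC, hη⟩ := h.exists_bound
  refine ⟨16 * C, by positivity, fun k => ?_, fun m n => abs_sub_le_mul_dLog (fun k => ?_) m n⟩
  · rw [abs_of_nonneg (momentSeq_nonneg η k), momentSeq]
    have := integral_pow_le hη k
    rw [le_div_iff₀ (by positivity)] at this
    linarith
  · have h1 := integral_pow_le hη (k + 1)
    have h2 := integral_pow_sub_le hη hC k
    have h3 : (0 : ℝ) ≤ ∫ r : UnitIco, (r : ℝ) ^ (2 * (k + 1)) ∂η :=
      integral_nonneg fun r => pow_nonneg r.2.1 _
    have h4 : ∫ r : UnitIco, (r : ℝ) ^ (2 * (k + 1)) ∂η ≤ ∫ r : UnitIco, (r : ℝ) ^ (2 * k) ∂η :=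
      integral_mono (integrable_pow_coe _ _) (integrable_pow_coe _ _) fun r =>
        pow_le_pow_of_le_one r.2.1 r.2.2.le (by omega)
    have h5 : ((k : ℝ) + 1) * (4 * C / ((k : ℝ) + 1) ^ 2) ≤ 8 * C / ((k : ℝ) + 2) := by
      rw [← mul_div_assoc, div_le_div_iff₀ (by positivity) (by positivity)]
      have hk : (0 : ℝ) ≤ k := by positivity
      have : 0 ≤ C * ((k : ℝ) + 1) * k := by positivity
      nlinarith
    have h6 := mul_le_mul_of_nonneg_left h2 (show (0 : ℝ) ≤ (k : ℝ) + 1 by positivity)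
    have h7 : 0 ≤ C / ((k : ℝ) + 2) := by positivity
    have h8 : 16 * C / ((k : ℝ) + 2) = 16 * (C / ((k : ℝ) + 2)) := by ring
    have h9 : 8 * C / ((k : ℝ) + 2) = 8 * (C / ((k : ℝ) + 2)) := by ring
    have h10 : ((k + 1 : ℕ) : ℝ) + 1 = (k : ℝ) + 2 := by push_cast; ring
    have h11 : 0 ≤ ((k : ℝ) + 1) * (∫ r : UnitIco, (r : ℝ) ^ (2 * k) ∂η -
      ∫ r : UnitIco, (r : ℝ) ^ (2 * (k + 1)) ∂η) :=
      mul_nonneg (by positivity) (sub_nonneg.2 h4)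
    rw [h10] at h1
    rw [momentSeq, momentSeq, h10, h8, abs_le]
    constructor <;> nlinarith

theorem exists_gammaSeq_bounds {η : ComplexMeasure UnitIco} (h : η ∈ complexMeasureClass) :
    ∃ K : ℝ, 0 ≤ K ∧ (∀ k, ‖gammaSeq η k‖ ≤ K) ∧
      ∀ m n, ‖gammaSeq η m - gammaSeq η n‖ ≤ K * dLog m n := by
  obtain ⟨η₁, η₂, η₃, η₄, _, _, _, _, h₁, h₂, h₃, h₄, rfl⟩ := h
  obtain ⟨K₁, hK₁, hb₁, hl₁⟩ := exists_momentSeq_bounds h₁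
  obtain ⟨K₂, hK₂, hb₂, hl₂⟩ := exists_momentSeq_bounds h₂
  obtain ⟨K₃, hK₃, hb₃, hl₃⟩ := exists_momentSeq_bounds h₃
  obtain ⟨K₄, hK₄, hb₄, hl₄⟩ := exists_momentSeq_bounds h₄
  have hnorm : ∀ a b : ℝ, ‖(a : ℂ) + Complex.I * (b : ℂ)‖ ≤ |a| + |b| := fun a b => by
    refine (norm_add_le _ _).trans ?_
    simp
  refine ⟨K₁ + K₂ + K₃ + K₄, by positivity, fun k => ?_, fun m n => ?_⟩
  · rw [gammaSeq_toComplexMeasure]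
    refine (hnorm _ _).trans ?_
    have := abs_sub (momentSeq η₁ k) (momentSeq η₂ k)
    have := abs_sub (momentSeq η₃ k) (momentSeq η₄ k)
    have := hb₁ k
    have := hb₂ k
    have := hb₃ k
    have := hb₄ k
    linarith
  · rw [gammaSeq_toComplexMeasure, gammaSeq_toComplexMeasure]
    have e : ∀ a b c d : ℝ, ((a : ℂ) + Complex.I * (b : ℂ)) - ((c : ℂ) + Complex.I * (d : ℂ)) =
        ((a - c : ℝ) : ℂ) + Complex.I * ((b - d : ℝ) : ℂ) := fun a b c d => by
      push_cast
      ring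
    rw [e]
    refine (hnorm _ _).trans ?_
    rw [sub_sub_sub_comm, sub_sub_sub_comm (momentSeq η₃ m)]
    have := abs_sub (momentSeq η₁ m - momentSeq η₁ n) (momentSeq η₂ m - momentSeq η₂ n)
    have := abs_sub (momentSeq η₃ m - momentSeq η₃ n) (momentSeq η₄ m - momentSeq η₄ n)
    have := hl₁ m n
    have := hl₂ m n
    have := hl₃ m n
    have := hl₄ m n
    linarith

theorem memℓp_gammaSeq {η : ComplexMeasure UnitIco} (h : η ∈ complexMeasureClass) :
    Memℓp (E := fun _ : ℕ => ℂ) (gammaSeq η) ∞ := by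
  obtain ⟨K, _, hb, _⟩ := exists_gammaSeq_bounds h
  exact memℓp_infty ⟨K, by rintro _ ⟨k, rfl⟩; exact hb k⟩

theorem gammaSet_subset_BUC : gammaSet ⊆ BUC := by
  rintro x ⟨η, hη, hx⟩ ε hε
  obtain ⟨K, hK, _, hl⟩ := exists_gammaSeq_bounds hη
  refine ⟨ε / (K + 1), by positivity, fun m n hmn => ?_⟩
  rw [hx, hx]
  rw [lt_div_iff₀ (by positivity)] at hmn
  have h0 : 0 ≤ dLog m n := abs_nonneg _
  have := hl m n
  nlinarith

/-! ### The real vector space of eigenvalue sequences. -/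

/-- The real sequences that are differences of eigenvalue sequences of positive measures with
bounded `kappa`. -/
def momentSubmodule : Submodule ℝ (ℕ → ℝ) where
  carrier := {f | ∃ (η₁ η₂ : Measure UnitIco) (_ : IsFiniteMeasure η₁) (_ : IsFiniteMeasure η₂),
    HasBoundedKappa η₁ ∧ HasBoundedKappa η₂ ∧ ∀ k, f k = momentSeq η₁ k - momentSeq η₂ k}
  zero_mem' := ⟨0, 0, inferInstance, inferInstance, ⟨0, by rintro _ ⟨r, rfl⟩; simp [kappa]⟩,
    ⟨0, by rintro _ ⟨r, rfl⟩; simp [kappa]⟩, fun k => by simp⟩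
  add_mem' := by
    have hadd : ∀ (η₁ η₂ : Measure UnitIco) [IsFiniteMeasure η₁] [IsFiniteMeasure η₂],
        HasBoundedKappa η₁ → HasBoundedKappa η₂ → HasBoundedKappa (η₁ + η₂) := by
      rintro η₁ η₂ _ _ ⟨M₁, h₁⟩ ⟨M₂, h₂⟩
      refine ⟨M₁ + M₂, ?_⟩
      rintro _ ⟨r, rfl⟩
      refine le_trans (le_of_eq ?_) (add_le_add (h₁ ⟨r, rfl⟩) (h₂ ⟨r, rfl⟩))
      rw [kappa, kappa, kappa, measureReal_add_apply]
      ring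
    have hmom : ∀ (η₁ η₂ : Measure UnitIco) [IsFiniteMeasure η₁] [IsFiniteMeasure η₂] (k : ℕ),
        momentSeq (η₁ + η₂) k = momentSeq η₁ k + momentSeq η₂ k := by
      intro η₁ η₂ _ _ k
      rw [momentSeq, integral_add_measure (integrable_pow_coe _ _) (integrable_pow_coe _ _),
        mul_add]
      rfl
    rintro f g ⟨η₁, η₂, _, _, h₁, h₂, hf⟩ ⟨ξ₁, ξ₂, _, _, h₁', h₂', hg⟩
    refine ⟨η₁ + ξ₁, η₂ + ξ₂, inferInstance, inferInstance, hadd _ _ h₁ h₁', hadd _ _ h₂ h₂',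
      fun k => ?_⟩
    rw [hmom, hmom, Pi.add_apply, hf, hg]
    ring
  smul_mem' := by
    have hk : ∀ (c : NNReal) (η : Measure UnitIco), HasBoundedKappa η →
        HasBoundedKappa (c • η) := by
      rintro c η ⟨M, h⟩
      refine ⟨c * M, ?_⟩
      rintro _ ⟨r, rfl⟩
      refine le_trans (le_of_eq ?_) (mul_le_mul_of_nonneg_left (h ⟨r, rfl⟩) c.2)
      rw [kappa, kappa, measureReal_nnreal_smul_apply]
      ring
    have hmom : ∀ (c : NNReal) (η : Measure UnitIco) (k : ℕ),
        momentSeq (c • η) k = c * momentSeq η k := by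
      intro c η k
      rw [momentSeq, momentSeq, integral_smul_nnreal_measure, NNReal.smul_def, smul_eq_mul]
      ring
    rintro c f ⟨η₁, η₂, _, _, h₁, h₂, hf⟩
    rcases le_total 0 c with hc | hc
    · refine ⟨c.toNNReal • η₁, c.toNNReal • η₂, inferInstance, inferInstance, hk _ _ h₁, hk _ _ h₂,
        fun k => ?_⟩
      rw [hmom, hmom, Pi.smul_apply, hf, Real.coe_toNNReal c hc, smul_eq_mul]
      ring
    · refine ⟨(-c).toNNReal • η₂, (-c).toNNReal • η₁, inferInstance, inferInstance, hk _ _ h₂,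
        hk _ _ h₁, fun k => ?_⟩
      rw [hmom, hmom, Pi.smul_apply, hf, Real.coe_toNNReal (-c) (by linarith), smul_eq_mul]
      ring

theorem mem_gammaSet_of_re_im {x : LInf} (hre : (fun k => (x k).re) ∈ momentSubmodule)
    (him : (fun k => (x k).im) ∈ momentSubmodule) : x ∈ gammaSet := by
  obtain ⟨η₁, η₂, i₁, i₂, h₁, h₂, hx⟩ := hre
  obtain ⟨η₃, η₄, i₃, i₄, h₃, h₄, hy⟩ := him
  refine ⟨_, ⟨η₁, η₂, η₃, η₄, i₁, i₂, i₃, i₄, h₁, h₂, h₃, h₄, rfl⟩, fun k => ?_⟩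
  rw [gammaSeq_toComplexMeasure, ← hx, ← hy, mul_comm]
  exact (Complex.re_add_im _).symm

theorem memℓp_of_mem_momentSubmodule {f g : ℕ → ℝ} (hf : f ∈ momentSubmodule)
    (hg : g ∈ momentSubmodule) :
    Memℓp (E := fun _ : ℕ => ℂ) (fun k => (f k : ℂ) + (g k : ℂ) * Complex.I) ∞ := by
  obtain ⟨η₁, η₂, i₁, i₂, h₁, h₂, hx⟩ := hf
  obtain ⟨η₃, η₄, i₃, i₄, h₃, h₄, hy⟩ := hg
  convert memℓp_gammaSeq ⟨η₁, η₂, η₃, η₄, i₁, i₂, i₃, i₄, h₁, h₂, h₃, h₄, rfl⟩ using 2 with k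
  rw [gammaSeq_toComplexMeasure, ← hx, ← hy, mul_comm]

/-! ### Laplace-type integrals as eigenvalue sequences. -/

theorem lintegral_Ioc_exp_neg {c M T : ℝ} (hc : 0 < c) (hM : 0 ≤ M) (hT : 0 ≤ T) :
    ∫⁻ t in Ioc 0 T, ENNReal.ofReal (M * Real.exp (-(c * t))) =
      ENNReal.ofReal (M / c * (1 - Real.exp (-(c * T)))) := by
  have hcont : Continuous fun t : ℝ => M * Real.exp (-(c * t)) := by fun_prop
  rw [← ofReal_integral_eq_lintegral_ofReal (hcont.integrableOn_Ioc)
    (Filter.Eventually.of_forall fun t => by positivity),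
    ← intervalIntegral.integral_of_le hT]
  congr 1
  have hd : ∀ t ∈ uIcc 0 T,
      HasDerivAt (fun t : ℝ => -(M / c) * Real.exp (-(c * t))) (M * Real.exp (-(c * t))) t := by
    intro t _
    have h := ((((hasDerivAt_id t).const_mul c).neg).exp).const_mul (-(M / c))
    refine h.congr_deriv ?_
    field_simp
    rfl
  rw [intervalIntegral.integral_eq_sub_of_hasDerivAt hd (hcont.intervalIntegrable _ _)]
  simp
  ring

theorem mul_integral_comp_mul_left_Ioi (g : ℝ → ℝ) {x : ℝ} (hx : 0 < x) :
    x * ∫ t in Ioi 0, g (x * t) = ∫ u in Ioi 0, g u := by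
  rw [integral_comp_mul_left_Ioi g 0 hx, mul_zero, smul_eq_mul, mul_inv_cancel_left₀ hx.ne']

theorem integrableOn_exp_neg_mul {x : ℝ} (hx : 0 < x) :
    IntegrableOn (fun t : ℝ => Real.exp (-(x * t))) (Ioi 0) := by
  simpa only [neg_mul] using exp_neg_integrableOn_Ioi 0 hx

/-- The map `t ↦ exp (-c t / 2)` from `(0,∞)` to `[0,1)`, extended by `0`. -/
def expMap (c : ℝ) (hc : 0 < c) (t : ℝ) : UnitIco :=
  ⟨(Ioi (0 : ℝ)).indicator (fun t => Real.exp (-(c * t / 2))) t, by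
    by_cases h : 0 < t
    · rw [indicator_of_mem (mem_Ioi.2 h)]
      refine ⟨(Real.exp_pos _).le, Real.exp_lt_one_iff.2 ?_⟩
      have : 0 < c * t := by positivity
      linarith
    · rw [indicator_of_notMem (by simpa using h)]
      simp⟩

theorem measurable_expMap (c : ℝ) (hc : 0 < c) : Measurable (expMap c hc) :=
  Measurable.subtype_mk (Measurable.indicator (by fun_prop) measurableSet_Ioi)

theorem coe_expMap {c : ℝ} (hc : 0 < c) {t : ℝ} (ht : 0 < t) :
    (expMap c hc t : ℝ) = Real.exp (-(c * t / 2)) :=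
  indicator_of_mem (mem_Ioi.2 ht) fun t : ℝ => Real.exp (-(c * t / 2))

/-- The push-forward under `expMap` of the measure with density `b t * exp (-c t)`. -/
def expMeasureWith (c : ℝ) (hc : 0 < c) (b : ℝ → ℝ) : Measure UnitIco :=
  ((volume.restrict (Ioi 0)).withDensity
    fun t => ENNReal.ofReal (b t * Real.exp (-(c * t)))).map (expMap c hc)

section ExpMeasure

variable {c M : ℝ} {b : ℝ → ℝ}

/-- The preimage of `[r,1)` lies in `(0,T]` with `T = -2 log r / c`, and the density is at most `M
exp(-ct)`. The half in the exponent of `expMap` makes `exp(-cT) = r²`. For `r = 0` the whole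
half-line is used. -/
theorem expMeasureWith_Ici_le (hc : 0 < c) (hM : ∀ t, b t ≤ M) (hM0 : 0 ≤ M)
    (r : UnitIco) :
    expMeasureWith c hc b (Ici r) ≤ ENNReal.ofReal (M / c * (1 - (r : ℝ) ^ 2)) := by
  rw [expMeasureWith, Measure.map_apply (measurable_expMap c hc) measurableSet_Ici,
    withDensity_apply _ (measurable_expMap c hc measurableSet_Ici),
    Measure.restrict_restrict (measurable_expMap c hc measurableSet_Ici)]
  have hle : ∀ s : Set ℝ, ∫⁻ t in s, ENNReal.ofReal (b t * Real.exp (-(c * t))) ≤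
      ∫⁻ t in s, ENNReal.ofReal (M * Real.exp (-(c * t))) := fun s =>
    lintegral_mono fun t => ENNReal.ofReal_le_ofReal
      (mul_le_mul_of_nonneg_right (hM t) (Real.exp_pos _).le)
  refine (hle _).trans ?_
  rcases r.2.1.eq_or_lt with h0 | h0
  · rw [← h0]
    refine (lintegral_mono_set inter_subset_right).trans ?_
    rw [← ofReal_integral_eq_lintegral_ofReal ((integrableOn_exp_neg_mul hc).const_mul M)
      (Filter.Eventually.of_forall fun t => by positivity), integral_const_mul]
    refine ENNReal.ofReal_le_ofReal (le_of_eq ?_)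
    have := mul_integral_comp_mul_left_Ioi (fun u => Real.exp (-u)) hc
    rw [integral_exp_neg_Ioi_zero] at this
    rw [eq_div_of_mul_eq hc.ne' ((mul_comm _ _).trans this)]
    ring
  · have hlog : Real.log r < 0 := Real.log_neg h0 r.2.2
    have hT : 0 ≤ -(2 * Real.log r) / c := div_nonneg (by linarith) hc.le
    have hexp : Real.exp (-(c * (-(2 * Real.log r) / c))) = (r : ℝ) ^ 2 := by
      rw [mul_div_cancel₀ _ hc.ne', neg_neg, two_mul, Real.exp_add, Real.exp_log h0, sq]
    rw [← hexp, ← lintegral_Ioc_exp_neg hc hM0 hT]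
    refine lintegral_mono_set ?_
    rintro t ⟨htr, ht⟩
    refine ⟨ht, ?_⟩
    have h1 : (r : ℝ) ≤ (expMap c hc t : ℝ) := htr
    rw [coe_expMap hc ht, ← Real.log_le_iff_le_exp h0] at h1
    rw [le_div_iff₀ hc]
    linarith

theorem isFiniteMeasure_expMeasureWith (hc : 0 < c) (hM : ∀ t, b t ≤ M) (hM0 : 0 ≤ M) :
    IsFiniteMeasure (expMeasureWith c hc b) := by
  refine ⟨lt_of_le_of_lt (measure_mono ?_) (lt_of_le_of_lt
    (expMeasureWith_Ici_le hc hM hM0 ⟨0, by simp⟩) ENNReal.ofReal_lt_top)⟩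
  exact fun x _ => x.2.1

theorem hasBoundedKappa_expMeasureWith (hc : 0 < c) (hM : ∀ t, b t ≤ M) (hM0 : 0 ≤ M) :
    HasBoundedKappa (expMeasureWith c hc b) := by
  refine ⟨2 * (M / c), ?_⟩
  rintro _ ⟨r, rfl⟩
  have hr : 0 < 1 - (r : ℝ) ^ 2 := by
    have := r.2.1; have := r.2.2; nlinarith
  have h := ENNReal.toReal_mono ENNReal.ofReal_ne_top (expMeasureWith_Ici_le hc hM hM0 r)
  rw [ENNReal.toReal_ofReal (by positivity)] at h
  rw [kappa, div_le_iff₀ hr, measureReal_def]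
  linarith

/-- Under `expMap`, `r^(2k)` becomes `exp(-ckt)`; the weight `exp(-ct)` raises the exponent to
`c(k+1)`, matching the prefactor `k + 1`. -/
theorem momentSeq_expMeasureWith (hc : 0 < c) (hb : Measurable b) (hb0 : ∀ t, 0 ≤ b t) (k : ℕ) :
    momentSeq (expMeasureWith c hc b) k =
      2 * (((k : ℝ) + 1) * ∫ t in Ioi 0, Real.exp (-(c * ((k : ℝ) + 1) * t)) * b t) := by
  rw [momentSeq, expMeasureWith, integral_map (measurable_expMap c hc).aemeasurable
    (by fun_prop), integral_withDensity_eq_integral_toReal_smul (by fun_prop)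
    (Filter.Eventually.of_forall fun t => ENNReal.ofReal_lt_top), mul_assoc]
  congr 2
  refine setIntegral_congr_fun measurableSet_Ioi fun t ht => ?_
  simp only [smul_eq_mul]
  rw [ENNReal.toReal_ofReal (mul_nonneg (hb0 t) (Real.exp_pos _).le), coe_expMap hc ht,
    ← Real.exp_nat_mul, mul_assoc, ← Real.exp_add, mul_comm]
  congr 2
  push_cast
  ring

theorem laplace_mem_momentSubmodule (hc : 0 < c) (hb : Measurable b) (hb0 : ∀ t, 0 ≤ b t)
    (hM : ∀ t, b t ≤ M) :
    (fun k : ℕ => ((k : ℝ) + 1) * ∫ t in Ioi 0, Real.exp (-(c * ((k : ℝ) + 1) * t)) * b t) ∈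
      momentSubmodule := by
  have hM0 : 0 ≤ M := (hb0 0).trans (hM 0)
  have := isFiniteMeasure_expMeasureWith hc hM hM0
  have h : momentSeq (expMeasureWith c hc b) ∈ momentSubmodule :=
    ⟨expMeasureWith c hc b, 0, this, inferInstance, hasBoundedKappa_expMeasureWith hc hM hM0,
      ⟨0, by rintro _ ⟨r, rfl⟩; simp [kappa]⟩, fun k => by simp [momentSeq]⟩
  convert momentSubmodule.smul_mem (1 / 2 : ℝ) h using 1
  funext k
  rw [Pi.smul_apply, momentSeq_expMeasureWith hc hb hb0]
  simp

theorem integrableOn_exp_neg_mul_comp {x : ℝ} (hx : 0 < x) {g : ℝ → ℝ} (hg : Continuous g)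
    (hb : Measurable b) (hb0 : ∀ t, 0 ≤ b t) (hM : ∀ t, b t ≤ M) :
    IntegrableOn (fun t => Real.exp (-(x * t)) * g (Real.exp (-(x * t))) * b t) (Ioi 0) := by
  obtain ⟨K, hK⟩ := isCompact_Icc.exists_bound_of_continuousOn (s := Icc (0 : ℝ) 1) hg.continuousOn
  refine Integrable.mono' ((integrableOn_exp_neg_mul hx).mul_const (K * M)) (by fun_prop)
    ((ae_restrict_iff' measurableSet_Ioi).2 (Filter.Eventually.of_forall fun t ht => ?_))
  have ht' : (0 : ℝ) < t := ht
  have h1 : Real.exp (-(x * t)) ∈ Icc (0 : ℝ) 1 :=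
    ⟨(Real.exp_pos _).le, Real.exp_le_one_iff.2 (by have := mul_pos hx ht'; linarith)⟩
  rw [norm_mul, norm_mul, Real.norm_of_nonneg h1.1, Real.norm_of_nonneg (hb0 t), mul_assoc]
  exact mul_le_mul_of_nonneg_left (mul_le_mul (hK _ h1) (hM t) (hb0 t)
    ((norm_nonneg _).trans (hK _ h1))) h1.1

/-- The monomial of degree `n` comes from the measure with `c = n + 1`. The extra factor
`exp(-(k+1)t)` keeps `c` positive even for the constant term. -/
theorem polynomial_laplace_mem_momentSubmodule (p : Polynomial ℝ) (hb : Measurable b)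
    (hb0 : ∀ t, 0 ≤ b t) (hM : ∀ t, b t ≤ M) :
    (fun k : ℕ => ((k : ℝ) + 1) * ∫ t in Ioi 0,
      Real.exp (-(((k : ℝ) + 1) * t)) * p.eval (Real.exp (-(((k : ℝ) + 1) * t))) * b t) ∈
      momentSubmodule := by
  induction p using Polynomial.induction_on' with
  | add p q hp hq =>
    convert momentSubmodule.add_mem hp hq using 1
    funext k
    have hk : (0 : ℝ) < (k : ℝ) + 1 := by positivity
    rw [Pi.add_apply, ← mul_add, ← integral_add
      (integrableOn_exp_neg_mul_comp hk p.continuous hb hb0 hM)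
      (integrableOn_exp_neg_mul_comp hk q.continuous hb hb0 hM)]
    simp only [Polynomial.eval_add]
    congr 2
    funext t
    ring
  | monomial n a =>
    have hn : (0 : ℝ) < (n : ℝ) + 1 := by positivity
    convert momentSubmodule.smul_mem a (laplace_mem_momentSubmodule hn hb hb0 hM) using 1
    funext k
    rw [Pi.smul_apply, smul_eq_mul, mul_left_comm]
    congr 1
    rw [← integral_const_mul]
    congr 1
    funext t
    rw [Polynomial.eval_monomial, ← Real.exp_nat_mul]
    have : Real.exp (-(((n : ℝ) + 1) * ((k : ℝ) + 1) * t)) =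
        Real.exp (-(((k : ℝ) + 1) * t)) * Real.exp ((n : ℝ) * -(((k : ℝ) + 1) * t)) := by
      rw [← Real.exp_add]
      congr 1
      ring
    rw [this]
    ring

end ExpMeasure

/-! ### Approximation of sequences in `BUC` by localized kernels. -/

/-- A continuous nonnegative bump, positive exactly on `(a,b)`. -/
def bump (a b s : ℝ) : ℝ := max 0 ((s - a) * (b - s))

theorem continuous_bump (a b : ℝ) : Continuous (bump a b) := by
  unfold bump
  fun_prop

theorem bump_nonneg (a b s : ℝ) : 0 ≤ bump a b s := le_max_left _ _

theorem bump_pos {a b s : ℝ} (h : s ∈ Ioo a b) : 0 < bump a b s :=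
  lt_max_of_lt_right (mul_pos (sub_pos.2 h.1) (sub_pos.2 h.2))

theorem mem_Ioo_of_bump_ne_zero {a b s : ℝ} (hab : a ≤ b) (h : bump a b s ≠ 0) : s ∈ Ioo a b := by
  have h1 : 0 < (s - a) * (b - s) := by
    by_contra h'
    exact h (max_eq_left (not_lt.1 h'))
  constructor <;> by_contra hs <;> push Not at hs <;> nlinarith

theorem integral_exp_neg_mul_bump_pos {α : ℝ} (h0 : 0 < α) (h1 : α < 1) :
    0 < ∫ u in Ioi 0, Real.exp (-u) * bump (Real.exp (-1)) (Real.exp (-α)) (Real.exp (-u)) := by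
  have hint := integrableOn_exp_neg_mul_comp one_pos
    (continuous_bump (Real.exp (-1)) (Real.exp (-α))) (b := fun _ => 1) measurable_const
    (fun _ => zero_le_one) (fun _ => le_rfl)
  simp only [one_mul, mul_one] at hint
  rw [setIntegral_pos_iff_support_of_nonneg_ae (Filter.Eventually.of_forall fun u =>
    mul_nonneg (Real.exp_pos _).le (bump_nonneg _ _ _)) hint]
  have hsub : Ioo α 1 ⊆ Function.support (fun u => Real.exp (-u) *
      bump (Real.exp (-1)) (Real.exp (-α)) (Real.exp (-u))) ∩ Ioi 0 := by
    intro u hu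
    refine ⟨(mul_pos (Real.exp_pos _) (bump_pos ⟨?_, ?_⟩)).ne', h0.trans hu.1⟩
    · exact Real.exp_lt_exp.2 (neg_lt_neg hu.2)
    · exact Real.exp_lt_exp.2 (neg_lt_neg hu.1)
  refine lt_of_lt_of_le ?_ (measure_mono hsub)
  rw [Real.volume_Ioo]
  exact ENNReal.ofReal_pos.2 (by linarith)

/-- The hypotheses place `1/t` between `k + 1` and `(k+1) exp(δ/2)`. Taking the floor cannot go
below the integer `k + 1`, so the logarithmic distance is at most `δ/2`. -/
theorem dLog_floor_lt {δ t : ℝ} {k : ℕ} (hδ : 0 < δ) (h1 : ((k : ℝ) + 1) * t < 1)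
    (h2 : Real.exp (-(δ / 2)) < ((k : ℝ) + 1) * t) : dLog (⌊1 / t⌋₊ - 1) k < δ := by
  have hk : (0 : ℝ) < (k : ℝ) + 1 := by positivity
  have ht : 0 < t := by
    by_contra h
    have := mul_nonpos_of_nonneg_of_nonpos hk.le (not_lt.1 h)
    have := Real.exp_pos (-(δ / 2))
    linarith
  have hle : (k : ℝ) + 1 ≤ 1 / t := by
    rw [le_div_iff₀ ht]
    exact h1.le
  have hfl : k + 1 ≤ ⌊1 / t⌋₊ := Nat.le_floor (by push_cast; exact hle)
  have hcast : ((⌊1 / t⌋₊ - 1 : ℕ) : ℝ) + 1 = (⌊1 / t⌋₊ : ℝ) := by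
    rw [Nat.cast_sub (by omega)]
    simp
  have hfl' : (k : ℝ) + 1 ≤ (⌊1 / t⌋₊ : ℝ) := by exact_mod_cast hfl
  have hup : (⌊1 / t⌋₊ : ℝ) ≤ ((k : ℝ) + 1) * Real.exp (δ / 2) := by
    refine (Nat.floor_le (by positivity)).trans ?_
    rw [div_le_iff₀ ht]
    have := mul_le_mul_of_nonneg_left h2.le (Real.exp_pos (δ / 2)).le
    rw [← Real.exp_add, add_neg_cancel, Real.exp_zero] at this
    linarith
  have hlog1 := Real.log_le_log hk hfl'
  have hlog2 := Real.log_le_log (hk.trans_le hfl') hup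
  rw [Real.log_mul hk.ne' (Real.exp_pos _).ne', Real.log_exp] at hlog2
  rw [dLog, hcast, abs_of_nonneg (by linarith)]
  linarith

theorem exists_mem_momentSubmodule_near_of_nonneg {σ : ℕ → ℝ} {M : ℝ} (h0 : ∀ k, 0 ≤ σ k)
    (hM : ∀ k, σ k ≤ M)
    (huc : ∀ ε : ℝ, 0 < ε → ∃ δ : ℝ, 0 < δ ∧ ∀ m n : ℕ, dLog m n < δ → |σ m - σ n| < ε)
    {ε : ℝ} (hε : 0 < ε) : ∃ f ∈ momentSubmodule, ∀ k, |f k - σ k| ≤ 2 * ε := by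
  obtain ⟨δ, hδ, hσ⟩ := huc ε hε
  have hM0 : 0 ≤ M := (h0 0).trans (hM 0)
  set α := Real.exp (-(δ / 2)) with hα
  have hα0 : 0 < α := Real.exp_pos _
  have hα1 : α < 1 := Real.exp_lt_one_iff.2 (by linarith)
  set ψ := bump (Real.exp (-1)) (Real.exp (-α)) with hψ
  have hψc : Continuous ψ := continuous_bump _ _
  set A := ∫ u in Ioi 0, Real.exp (-u) * ψ (Real.exp (-u)) with hA
  have hApos : 0 < A := integral_exp_neg_mul_bump_pos hα0 hα1
  -- Chosen so that the polynomial error `ε' * M` is at most `A * ε`; the `+ 1` covers `M = 0`.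
  set ε' := A * ε / (M + 1) with hε'
  have hε'pos : 0 < ε' := by positivity
  obtain ⟨p, hp⟩ := exists_polynomial_near_of_continuousOn 0 1 ψ hψc.continuousOn ε' hε'pos
  -- Inverts `t ≈ 1/(k+1)`. For `t > 1` truncated subtraction gives index 0, but such `t` lie
  -- outside every window `(k+1)t < 1`.
  set b : ℝ → ℝ := fun t => σ (⌊1 / t⌋₊ - 1) with hb
  have hbm : Measurable b := by
    have : Measurable fun n : ℕ => σ (n - 1) := measurable_from_nat
    exact this.comp (Nat.measurable_floor.comp (by fun_prop))
  have hmem := polynomial_laplace_mem_momentSubmodule p hbm (fun t => h0 _) (fun t => hM _)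
  refine ⟨_, momentSubmodule.smul_mem A⁻¹ hmem, fun k => ?_⟩
  set x : ℝ := (k : ℝ) + 1 with hx
  have hx0 : 0 < x := by positivity
  set E : ℝ → ℝ := fun t => Real.exp (-(x * t)) with hE
  have hint1 : IntegrableOn (fun t => E t * p.eval (E t) * b t) (Ioi 0) :=
    integrableOn_exp_neg_mul_comp hx0 p.continuous hbm (fun t => h0 _) (fun t => hM _)
  have hint2 : IntegrableOn (fun t => E t * ψ (E t) * σ k) (Ioi 0) :=
    integrableOn_exp_neg_mul_comp hx0 hψc measurable_const (fun t => h0 k) (fun t => hM k)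
  have hint3 : IntegrableOn (fun t => E t * ψ (E t) * ε) (Ioi 0) :=
    integrableOn_exp_neg_mul_comp hx0 hψc measurable_const (fun t => hε.le) (fun t => le_rfl)
  have hint4 : IntegrableOn (fun t => E t * (ε' * M)) (Ioi 0) :=
    (integrableOn_exp_neg_mul hx0).mul_const _
  -- Substituting `u = xt` shows that the normalizing constant `A` is the same for every `k`.
  have hψint : x * ∫ t in Ioi 0, E t * ψ (E t) = A :=
    mul_integral_comp_mul_left_Ioi (fun u => Real.exp (-u) * ψ (Real.exp (-u))) hx0
  have hEint : x * ∫ t in Ioi 0, E t = 1 :=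
    (mul_integral_comp_mul_left_Ioi (fun u => Real.exp (-u)) hx0).trans integral_exp_neg_Ioi_zero
  have hpt : ∀ t ∈ Ioi (0 : ℝ), ‖E t * p.eval (E t) * b t - E t * ψ (E t) * σ k‖ ≤
      E t * (ε' * M) + E t * ψ (E t) * ε := by
    intro t ht
    have ht0 : (0 : ℝ) < t := ht
    have hE0 : 0 < E t := Real.exp_pos _
    have hE1 : E t ≤ 1 := Real.exp_le_one_iff.2 (by have := mul_pos hx0 ht0; linarith)
    have e : E t * p.eval (E t) * b t - E t * ψ (E t) * σ k =
        E t * ((p.eval (E t) - ψ (E t)) * b t) + E t * (ψ (E t) * (b t - σ k)) := by ring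
    rw [e, Real.norm_eq_abs, mul_assoc (E t) (ψ (E t))]
    refine (abs_add_le _ _).trans ?_
    rw [abs_mul, abs_mul, abs_mul, abs_mul, abs_of_pos hE0, abs_of_nonneg (h0 _ : 0 ≤ b t),
      abs_of_nonneg (bump_nonneg _ _ _ : 0 ≤ ψ (E t))]
    refine add_le_add (mul_le_mul_of_nonneg_left (mul_le_mul (hp _ ⟨hE0.le, hE1⟩).le (hM _)
      (h0 _) hε'pos.le) hE0.le) (mul_le_mul_of_nonneg_left ?_ hE0.le)
    -- Where `ψ (E t)` is nonzero, `α < xt < 1`, so the index used by `b t` is within `δ` of `k`.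
    by_cases hz : ψ (E t) = 0
    · have hz' : bump (Real.exp (-1)) (Real.exp (-α)) (E t) = 0 := hz
      rw [hz', zero_mul]
      exact mul_nonneg (bump_nonneg _ _ _) hε.le
    · have hmem := mem_Ioo_of_bump_ne_zero
        (Real.exp_le_exp.2 (by linarith : -(1 : ℝ) ≤ -α)) hz
      have h1 := neg_lt_neg_iff.1 (Real.exp_lt_exp.1 hmem.1)
      have h2 := neg_lt_neg_iff.1 (Real.exp_lt_exp.1 hmem.2)
      exact mul_le_mul_of_nonneg_left (hσ _ _ (dLog_floor_lt hδ h1 h2)).le (bump_nonneg _ _ _)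
  have hdiff : |(x * ∫ t in Ioi 0, E t * p.eval (E t) * b t) - A * σ k| ≤ ε' * M + A * ε := by
    have e1 : (x * ∫ t in Ioi 0, E t * p.eval (E t) * b t) - A * σ k =
        x * ∫ t in Ioi 0, (E t * p.eval (E t) * b t - E t * ψ (E t) * σ k) := by
      rw [integral_sub hint1 hint2, integral_mul_const, ← hψint]
      ring
    have e2 : ε' * M + A * ε = x * ∫ t in Ioi 0, (E t * (ε' * M) + E t * ψ (E t) * ε) := by
      rw [integral_add hint4 hint3, integral_mul_const, integral_mul_const, ← hψint, mul_add,
        ← mul_assoc, hEint, one_mul, mul_assoc]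
    rw [e1, e2, abs_mul, abs_of_pos hx0]
    refine mul_le_mul_of_nonneg_left ?_ hx0.le
    exact norm_integral_le_of_norm_le (hint4.add hint3)
      ((ae_restrict_iff' measurableSet_Ioi).2 (Filter.Eventually.of_forall hpt))
  have hε'M : ε' * M ≤ A * ε := by
    rw [hε', div_mul_eq_mul_div, div_le_iff₀ (by positivity)]
    have : 0 ≤ A * ε := by positivity
    nlinarith
  have e3 : A⁻¹ * (x * ∫ t in Ioi 0, E t * p.eval (E t) * b t) - σ k =
      A⁻¹ * ((x * ∫ t in Ioi 0, E t * p.eval (E t) * b t) - A * σ k) := by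
    field_simp
  change |A⁻¹ * (x * ∫ t in Ioi 0, E t * p.eval (E t) * b t) - σ k| ≤ 2 * ε
  rw [e3, abs_mul, abs_of_pos (inv_pos.2 hApos), inv_mul_le_iff₀ hApos]
  linarith

theorem exists_mem_momentSubmodule_near {σ : ℕ → ℝ} {M : ℝ} (hM : ∀ k, |σ k| ≤ M)
    (huc : ∀ ε : ℝ, 0 < ε → ∃ δ : ℝ, 0 < δ ∧ ∀ m n : ℕ, dLog m n < δ → |σ m - σ n| < ε)
    {ε : ℝ} (hε : 0 < ε) : ∃ f ∈ momentSubmodule, ∀ k, |f k - σ k| ≤ ε := by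
  have hM0 : 0 ≤ M := (abs_nonneg _).trans (hM 0)
  -- Shifting by `M` makes the sequence nonnegative; an approximant of the constant `M` is
  -- subtracted afterwards. Each contributes an error of `2 * (ε / 4)`.
  obtain ⟨f, hf, hfσ⟩ := exists_mem_momentSubmodule_near_of_nonneg (σ := fun k => σ k + M)
    (M := 2 * M) (fun k => by linarith [(abs_le.1 (hM k)).1])
    (fun k => by linarith [(abs_le.1 (hM k)).2])
    (fun ε hε => by simpa only [add_sub_add_right_eq_sub] using huc ε hε)
    (show 0 < ε / 4 by positivity)
  obtain ⟨g, hg, hgM⟩ := exists_mem_momentSubmodule_near_of_nonneg (σ := fun _ => M)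
    (M := M) (fun _ => hM0) (fun _ => le_rfl)
    (fun ε hε => ⟨1, one_pos, fun _ _ _ => by simpa using hε⟩)
    (show 0 < ε / 4 by positivity)
  refine ⟨f - g, momentSubmodule.sub_mem hf hg, fun k => ?_⟩
  have h1 := abs_le.1 (hfσ k)
  have h2 := abs_le.1 (hgM k)
  rw [Pi.sub_apply, abs_le]
  constructor <;> linarith

theorem BUC_subset_closure_gammaSet : BUC ⊆ closure gammaSet := by
  intro x hx
  rw [Metric.mem_closure_iff]
  intro ε hε
  have hbd : ∀ k, ‖x k‖ ≤ ‖x‖ := fun k => lp.norm_apply_le_norm ENNReal.top_ne_zero x k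
  obtain ⟨f, hf, hfx⟩ := exists_mem_momentSubmodule_near (σ := fun k => (x k).re)
    (fun k => (Complex.abs_re_le_norm _).trans (hbd k))
    (fun ε hε => by
      obtain ⟨δ, hδ, h⟩ := hx ε hε
      refine ⟨δ, hδ, fun m n hmn => lt_of_le_of_lt ?_ (h m n hmn)⟩
      rw [← Complex.sub_re]
      exact Complex.abs_re_le_norm _) (show 0 < ε / 4 by positivity)
  obtain ⟨g, hg, hgx⟩ := exists_mem_momentSubmodule_near (σ := fun k => (x k).im)
    (fun k => (Complex.abs_im_le_norm _).trans (hbd k))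
    (fun ε hε => by
      obtain ⟨δ, hδ, h⟩ := hx ε hε
      refine ⟨δ, hδ, fun m n hmn => lt_of_le_of_lt ?_ (h m n hmn)⟩
      rw [← Complex.sub_im]
      exact Complex.abs_im_le_norm _) (show 0 < ε / 4 by positivity)
  let y : LInf := ⟨fun k => (f k : ℂ) + (g k : ℂ) * Complex.I, memℓp_of_mem_momentSubmodule hf hg⟩
  have hy : ∀ k, y k = (f k : ℂ) + (g k : ℂ) * Complex.I := fun k => rfl
  refine ⟨y, mem_gammaSet_of_re_im ?_ ?_, ?_⟩
  · simpa [hy] using hf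
  · simpa [hy] using hg
  · rw [dist_comm, dist_eq_norm]
    refine lt_of_le_of_lt (lp.norm_le_of_forall_le (C := ε / 2) (by positivity) fun k => ?_)
      (by linarith)
    rw [lp.coeFn_sub, Pi.sub_apply]
    refine (Complex.norm_le_abs_re_add_abs_im _).trans ?_
    have h1 : (y k - x k).re = f k - (x k).re := by simp [hy]
    have h2 : (y k - x k).im = g k - (x k).im := by simp [hy]
    rw [h1, h2]
    linarith [hfx k, hgx k]

/-! ### `BUC` as a closed star-subalgebra. -/

/-- The bounded sequences that are uniformly continuous for `dLog`, as a star-subalgebra. -/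
def bucSubalgebra : NonUnitalStarSubalgebra ℂ LInf where
  carrier := BUC
  zero_mem' := fun ε hε => ⟨1, one_pos, fun m n _ => by simpa using hε⟩
  add_mem' := by
    intro x y hx hy ε hε
    obtain ⟨δ, hδ, h⟩ := hx (ε / 2) (by positivity)
    obtain ⟨δ', hδ', h'⟩ := hy (ε / 2) (by positivity)
    refine ⟨min δ δ', lt_min hδ hδ', fun m n hmn => ?_⟩
    have h1 := h m n (hmn.trans_le (min_le_left _ _))
    have h2 := h' m n (hmn.trans_le (min_le_right _ _))
    rw [lp.coeFn_add, Pi.add_apply, Pi.add_apply, add_sub_add_comm]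
    exact (norm_add_le _ _).trans_lt (by linarith)
  mul_mem' := by
    intro x y hx hy ε hε
    have hbx : ∀ k, ‖x k‖ ≤ ‖x‖ := fun k => lp.norm_apply_le_norm ENNReal.top_ne_zero x k
    have hby : ∀ k, ‖y k‖ ≤ ‖y‖ := fun k => lp.norm_apply_le_norm ENNReal.top_ne_zero y k
    have hC : 0 < ‖x‖ + ‖y‖ + 1 := by positivity
    obtain ⟨δ, hδ, h⟩ := hx (ε / (‖x‖ + ‖y‖ + 1)) (by positivity)
    obtain ⟨δ', hδ', h'⟩ := hy (ε / (‖x‖ + ‖y‖ + 1)) (by positivity)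
    refine ⟨min δ δ', lt_min hδ hδ', fun m n hmn => ?_⟩
    have h1 := h m n (hmn.trans_le (min_le_left _ _))
    have h2 := h' m n (hmn.trans_le (min_le_right _ _))
    have e : (x * y) m - (x * y) n = x m * (y m - y n) + (x m - x n) * y n := by
      rw [lp.infty_coeFn_mul, Pi.mul_apply, Pi.mul_apply]
      ring
    set η := ε / (‖x‖ + ‖y‖ + 1) with hη
    have hηε : η * (‖x‖ + ‖y‖ + 1) = ε := div_mul_cancel₀ _ hC.ne'
    have hη0 : 0 < η := by positivity
    rw [e]
    refine (norm_add_le _ _).trans_lt ?_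
    rw [norm_mul, norm_mul]
    have h3 := mul_le_mul (hbx m) h1.le (norm_nonneg _) (norm_nonneg x)
    have h3' := mul_le_mul (hbx m) h2.le (norm_nonneg _) (norm_nonneg x)
    have h4 := mul_le_mul h1.le (hby n) (norm_nonneg _) hη0.le
    linarith
  smul_mem' := by
    intro c x hx ε hε
    obtain ⟨δ, hδ, h⟩ := hx (ε / (‖c‖ + 1)) (by positivity)
    refine ⟨δ, hδ, fun m n hmn => ?_⟩
    have h1 := h m n hmn
    rw [lt_div_iff₀ (by positivity)] at h1
    rw [lp.coeFn_smul, Pi.smul_apply, Pi.smul_apply, ← smul_sub, norm_smul]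
    have := norm_nonneg (x m - x n)
    linarith
  star_mem' := by
    intro x hx ε hε
    obtain ⟨δ, hδ, h⟩ := hx ε hε
    refine ⟨δ, hδ, fun m n hmn => ?_⟩
    rw [lp.coeFn_star, Pi.star_apply, Pi.star_apply, ← star_sub, norm_star]
    exact h m n hmn

theorem isClosed_BUC : IsClosed BUC := by
  refine isClosed_of_closure_subset fun x hx ε hε => ?_
  obtain ⟨y, hy, hxy⟩ := Metric.mem_closure_iff.1 hx (ε / 3) (by positivity)
  obtain ⟨δ, hδ, h⟩ := hy (ε / 3) (by positivity)
  refine ⟨δ, hδ, fun m n hmn => ?_⟩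
  have hk : ∀ k, ‖x k - y k‖ < ε / 3 := fun k => by
    have := lp.norm_apply_le_norm ENNReal.top_ne_zero (x - y) k
    rw [lp.coeFn_sub, Pi.sub_apply] at this
    rw [dist_eq_norm] at hxy
    exact this.trans_lt hxy
  have e : x m - x n = (x m - y m) + (y m - y n) - (x n - y n) := by ring
  rw [e]
  have h1 := norm_sub_le ((x m - y m) + (y m - y n)) (x n - y n)
  have h2 := norm_add_le (x m - y m) (y m - y n)
  linarith [hk m, hk n, h m n hmn]

/-- Density already yields one inclusion without forming any products; the algebra structure of
`BUC` serves only for the other. -/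
theorem cstarGenerated_gammaSet : (cstarGenerated gammaSet : Set LInf) = BUC := by
  refine Subset.antisymm ?_ ?_
  · have h1 : NonUnitalStarAlgebra.adjoin ℂ gammaSet ≤ bucSubalgebra :=
      NonUnitalStarAlgebra.adjoin_le gammaSet_subset_BUC
    exact NonUnitalStarSubalgebra.topologicalClosure_minimal _ h1 isClosed_BUC
  · refine BUC_subset_closure_gammaSet.trans ?_
    exact closure_mono (NonUnitalStarAlgebra.subset_adjoin ℂ gammaSet)

end RadialToeplitz

end

theorem mainTheorem4 :
    -- every `γ_η` is a bounded sequence, so that `gammaSet` really contains all of them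
    (∀ η ∈ RadialToeplitz.complexMeasureClass,
      Memℓp (E := fun _ : ℕ => ℂ) (RadialToeplitz.gammaSeq η) ∞) ∧
    -- `gammaSet` is a dense subset of `BUC` for the supremum norm
    RadialToeplitz.gammaSet ⊆ RadialToeplitz.BUC ∧
    RadialToeplitz.BUC ⊆ closure RadialToeplitz.gammaSet ∧
    -- the C*-subalgebra generated by `gammaSet` is `BUC`
    (RadialToeplitz.cstarGenerated RadialToeplitz.gammaSet : Set RadialToeplitz.LInf)
      = RadialToeplitz.BUC :=
  ⟨fun _ hη => RadialToeplitz.memℓp_gammaSeq hη, RadialToeplitz.gammaSet_subset_BUC,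
    RadialToeplitz.BUC_subset_closure_gammaSet, RadialToeplitz.cstarGenerated_gammaSet⟩
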